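/- Let $\Theta=\varprojlim_m \mathbb Z/m\mathbb Z$ (inverse limit over the positive integers ordered by divisibility, with the inverse limit topology), let $\Pi:\mathbb Z\to\Theta$ be the canonical ring homomorphism and $\tau(t)=t+1$ on $\Theta$. Let $\mathbb Z_*=\mathbb Z\cup\{\pm\infty\}$ be the two point compactification of $\mathbb Z$, with $\tau$ the translation by $1$ fixing $\pm\infty$, and let the spiral be $$\Sigma=\{(x,t)\in\mathbb Z_*\times\Theta:\ x=\pm\infty,\ \text{or } x\in\mathbb Z \text{ and } t=\Pi(x)\}$$ with the homeomorphism $\tau$ obtained by restricting $\tau\times\tau$. Let $A_0\subset A$ be closed subsets of $[0,1]$ such that $A_0$ is nowhere dense and contains the boundary of $A$ in $\mathbb R$. Let $\mathcal J$ be the set of connected components of $A\setminus A_0$; each $j\in\mathcal J$ is an open interval $(j_-,j_+)$ with $j_\pm\in A_0$. Let $Z(A,A_0)$ be the set obtained from the disjoint union of $\mathcal J\times\Sigma$ and $A_0\times\Theta$ by the identifications $(j,-\infty,t)=(j_-,t)$ and $(j,+\infty,t)=(j_+,t)$ for $j\in\mathcal J$, $t\in\Theta$. Let $\zeta:Z(A,A_0)\to\Theta$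 be the projection to the $\Theta$-coordinate, and let $q:Z(A,A_0)\to A$ be the map with $q(a,t)=a$ on $A_0\times\Theta$ and $$q(j,(x,\Pi(x)))=j_-+(j_+-j_-)\,\tfrac12\Bigl(1+\tfrac{x}{1+|x|}\Bigr)\qquad (j\in\mathcal J,\ x\in\mathbb Z).$$ Give $Z(A,A_0)$ the topology for which $q\times\zeta:Z(A,A_0)\to[0,1]\times\Theta$ is an embedding. The maps $1_{\mathcal J}\times\tau$ and $1_{A_0}\times\tau$ induce a homeomorphism $\tau_{(A,A_0)}$ of $Z(A,A_0)$. With $C$ the classical Cantor set put $$X(A,A_0)=Z(A,A_0)\times C,\qquad T(A,A_0)=\tau_{(A,A_0)}\times 1_C .$$ **Proposition.** If, in addition, $A_0\neq A$, then $T=T(A,A_0)$ is of dense type in the group $\mathcal H(X)$ of homeomorphisms of $X=X(A,A_0)$ with the topology of uniform convergence, that is, its conjugacy class $\{H\circ T\circ H^{-1}:H\in\mathcal H(X)\}$ is dense in $\mathcal H(X)$; moreover $T$ represents every surjective relation on a finite set: for every nonempty finite set $W$ and every $R\subset W\times W$ mapping onto $W$ under both projections there is a continuous surjection $\phi:X\to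 W$ ($W$ discrete) such that, for all $a,b\in W$, $$(a,b)\in R\iff \phi(x)=a \text{ and } \phi(T(x))=b \text{ for some } x\in X .$$ -/

import Mathlib

open Set Filter Topology

namespace SpiralSpace

/-! ### Dense type and finite relations -/

/-- The topology of the homeomorphism group `H(X)`: the compact-open topology, i.e. for compact
metrizable `X` the topology of uniform convergence. -/
instance homeoTopology (X : Type*) [TopologicalSpace X] : TopologicalSpace (X ≃ₜ X) :=
  TopologicalSpace.induced (fun h : X ≃ₜ X => (h : C(X, X))) inferInstance

/-- The orbit of `T` under the adjoint action: all `H ∘ T ∘ H⁻¹` with `H ∈ H(X)`. -/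
def conjOrbit {X : Type*} [TopologicalSpace X] (T : X ≃ₜ X) : Set (X ≃ₜ X) :=
  {S | ∃ H : X ≃ₜ X, S = (H.symm.trans T).trans H}

/-- `T` is of dense type when its conjugacy class is dense in `H(X)`. -/
def IsDenseType {X : Type*} [TopologicalSpace X] (T : X ≃ₜ X) : Prop :=
  closure (conjOrbit T) = Set.univ

/-- A relation on `W` mapping onto `W` under each of the two projections. -/
def IsSurjectiveRelation {W : Type*} (R : W → W → Prop) : Prop :=
  (∀ a, ∃ b, R a b) ∧ (∀ b, ∃ a, R a b)

/-- `T` represents `R` (on a discrete space `W`): some continuous surjection `φ : X → W` has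
`(φ × φ)(T) = R`, where `T` is identified with its graph. -/
def Represents {X : Type*} [TopologicalSpace X] (T : X ≃ₜ X)
    {W : Type*} [TopologicalSpace W] (R : W → W → Prop) : Prop :=
  ∃ φ : X → W, Continuous φ ∧ Function.Surjective φ ∧
    ∀ a b, R a b ↔ ∃ x, φ x = a ∧ φ (T x) = b

/-! ### The universal adding machine -/

/-- The inverse limit of the rings `ℤ / m`, over the positive integers ordered by divisibility,
as a subring of their product. -/
def thetaSubring : Subring (∀ m : ℕ+, ZMod (m : ℕ)) where
  carrier := {f | ∀ (m n : ℕ+) (h : (m : ℕ) ∣ (n : ℕ)), ZMod.castHom h (ZMod (m : ℕ)) (f n) = f m}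
  mul_mem' := by
    intro f g hf hg m n h
    simp only [Pi.mul_apply, map_mul]
    rw [hf m n h, hg m n h]
  one_mem' := by intro m n h; simp only [Pi.one_apply, map_one]
  add_mem' := by
    intro f g hf hg m n h
    simp only [Pi.add_apply, map_add]
    rw [hf m n h, hg m n h]
  zero_mem' := by intro m n h; simp only [Pi.zero_apply, map_zero]
  neg_mem' := by
    intro f hf m n h
    simp only [Pi.neg_apply, map_neg]
    rw [hf m n h]

/-- The ring `Θ`, with the topology induced from the product of the discrete rings `ℤ / m`. -/
abbrev Theta : Type := thetaSubring

/-! ### The spiral -/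

/-- The points of the two point compactification of `ℤ`. -/
inductive ZStar : Type
  | negInf : ZStar
  | fin : ℤ → ZStar
  | posInf : ZStar

/-- Translation by `k` on `ℤ`, fixing the two points at infinity. -/
def ZStar.shift (k : ℤ) : ZStar → ZStar
  | .negInf => .negInf
  | .fin n => .fin (n + k)
  | .posInf => .posInf

/-- The underlying set of the spiral: `(x, t)` with `x = ± ∞`, or `x ∈ ℤ` and `t = Π(x)`, where
`Π : ℤ → Θ` is the canonical ring homomorphism. -/
def spiralSet : Set (ZStar × Theta) :=
  {p | p.1 = .negInf ∨ p.1 = .posInf ∨ ∃ n : ℤ, p.1 = .fin n ∧ p.2 = (n : Theta)}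

abbrev Spiral : Type := spiralSet

/-- The `k`-th iterate of the homeomorphism `τ × τ` of the spiral. -/
def Spiral.shift (k : ℤ) (p : Spiral) : Spiral :=
  ⟨(p.1.1.shift k, p.1.2 + (k : Theta)), by
    obtain ⟨⟨x, t⟩, h | h | ⟨n, h, h'⟩⟩ := p
    · left; simp only at h; subst h; rfl
    · right; left; simp only at h; subst h; rfl
    · right; right
      simp only at h h'
      subst h h'
      exact ⟨n + k, rfl, by push_cast; rfl⟩⟩

/-- The order preserving embedding `ℤ ∪ {± ∞} → [0, 1]`, sending `n ∈ ℤ` to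
`(1 + n / (1 + |n|)) / 2`, which fixes how wandering orbits are placed in an interval. -/
noncomputable def ZStar.pos : ZStar → ℝ
  | .negInf => 0
  | .fin n => (1 + (n : ℝ) / (1 + |(n : ℝ)|)) / 2
  | .posInf => 1

/-! ### The space of spirals `Z(A, A₀)` -/

/-- The standing assumptions on `(A, A₀)`: closed subsets of `[0, 1]` with
`A ⊇ A₀ ⊇ Bdry A` and `A₀` nowhere dense. Boundary and nowhere density are taken in `ℝ`. -/
structure SpiralPair (A A₀ : Set ℝ) : Prop where
  subset_unit : A ⊆ Icc 0 1
  isClosed : IsClosed A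
  isClosed₀ : IsClosed A₀
  subset : A₀ ⊆ A
  frontier_subset : frontier A ⊆ A₀
  nowhereDense : IsNowhereDense A₀

/-- `𝒥(A \ A₀)`: the set of connected components of `A \ A₀`. Each one is an open interval `j`
with end points `j₋ = sInf j` and `j₊ = sSup j` (see `SpiralPair.gap_spec`). -/
abbrev Gap (A A₀ : Set ℝ) : Type :=
  {j : Set ℝ // ∃ x ∈ A \ A₀, j = connectedComponentIn (A \ A₀) x}

/-- The disjoint union of `𝒥(A \ A₀) × Σ` and `A₀ × Θ`. -/
abbrev PreZ (A A₀ : Set ℝ) : Type := (Gap A A₀ × Spiral) ⊕ (A₀ × Theta)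

/-- The identifications `(j, - ∞, t) = (j₋, t)` and `(j, + ∞, t) = (j₊, t)`. -/
inductive Glue (A A₀ : Set ℝ) : PreZ A A₀ → PreZ A A₀ → Prop
  | left (j : Gap A A₀) (a : A₀) (t : Theta) (h : (a : ℝ) = sInf j.1) :
      Glue A A₀ (.inl (j, ⟨(.negInf, t), Or.inl rfl⟩)) (.inr (a, t))
  | right (j : Gap A A₀) (a : A₀) (t : Theta) (h : (a : ℝ) = sSup j.1) :
      Glue A A₀ (.inl (j, ⟨(.posInf, t), Or.inr (Or.inl rfl)⟩)) (.inr (a, t))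

/-- The points of `Z(A, A₀)`. -/
def Z (A A₀ : Set ℝ) : Type := Quot (Glue A A₀)

variable {A A₀ : Set ℝ}

noncomputable def preQ : PreZ A A₀ → ℝ
  | .inl (j, p) => sInf j.1 + (sSup j.1 - sInf j.1) * p.1.1.pos
  | .inr (a, _) => a

def preZeta : PreZ A A₀ → Theta
  | .inl (_, p) => p.1.2
  | .inr (_, t) => t

/-- The map `q : Z(A, A₀) → A ⊆ ℝ`: it collapses each adding machine `{a} × Θ` to `a` and places
each wandering orbit in its interval `j`, in an order preserving way, converging to `j₋`, `j₊`. -/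
noncomputable def q : Z A A₀ → ℝ :=
  Quot.lift preQ (by
    rintro _ _ (⟨j, a, t, h⟩ | ⟨j, a, t, h⟩)
    · simp [preQ, ZStar.pos, h]
    · simp [preQ, ZStar.pos, h])

/-- The map `ζ : Z(A, A₀) → Θ`. -/
def zeta : Z A A₀ → Theta :=
  Quot.lift preZeta (by rintro _ _ (⟨j, a, t, h⟩ | ⟨j, a, t, h⟩) <;> rfl)

/-- The topology of `Z(A, A₀)` is the one for which `q × ζ` is an embedding in `[0, 1] × Θ`.
(It is coarser than the quotient of the disjoint union topology, which is not compact when there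
are infinitely many intervals, and does not depend on the placement of the orbits.) -/
noncomputable instance : TopologicalSpace (Z A A₀) :=
  TopologicalSpace.induced (fun z => (q z, zeta z)) inferInstance

def preShift (k : ℤ) : PreZ A A₀ → PreZ A A₀
  | .inl (j, p) => .inl (j, p.shift k)
  | .inr (a, t) => .inr (a, t + (k : Theta))

/-- The `k`-th iterate of `τ_(A, A₀)`, induced by `1 × τ` on both parts of the disjoint union. -/
def shift (k : ℤ) : Z A A₀ → Z A A₀ :=
  Quot.map (preShift k) (by
    rintro _ _ (⟨j, a, t, h⟩ | ⟨j, a, t, h⟩)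
    · exact Glue.left j a _ h
    · exact Glue.right j a _ h)

theorem shift_shift {k l : ℤ} (h : k + l = 0) (z : Z A A₀) : shift l (shift k z) = z := by
  have hT : ∀ t : Theta, t + (k : Theta) + (l : Theta) = t := by
    intro t
    rw [add_assoc, ← Int.cast_add, h, Int.cast_zero, add_zero]
  induction z using Quot.ind with
  | mk w =>
    refine congrArg (Quot.mk _) ?_
    rcases w with ⟨j, ⟨⟨x, t⟩, hp⟩⟩ | ⟨a, t⟩
    · simp only [preShift, Spiral.shift, hT]
      cases x with
      | negInf => rfl
      | posInf => rfl
      | fin n => simp [ZStar.shift, add_assoc, h]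
    · simp only [preShift, hT]

theorem SpiralPair.isOpen_diff (h : SpiralPair A A₀) : IsOpen (A \ A₀) := by
  have : A \ A₀ = interior A \ A₀ := by
    ext x
    constructor
    · rintro ⟨hx, hx0⟩
      refine ⟨?_, hx0⟩
      by_contra hi
      exact hx0 (h.frontier_subset ⟨subset_closure hx, hi⟩)
    · rintro ⟨hx, hx0⟩
      exact ⟨interior_subset hx, hx0⟩
  rw [this]
  exact isOpen_interior.sdiff h.isClosed₀

/-- The components of `A \ A₀` are open intervals with end points in `A₀`. -/
theorem SpiralPair.gap_spec (h : SpiralPair A A₀) (j : Gap A A₀) :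
    sInf j.1 < sSup j.1 ∧ j.1 = Ioo (sInf j.1) (sSup j.1) ∧ sInf j.1 ∈ A₀ ∧ sSup j.1 ∈ A₀ := by
  obtain ⟨j, x, hx, rfl⟩ := j
  simp only
  set S := connectedComponentIn (A \ A₀) x with hS
  have hsub : S ⊆ A \ A₀ := connectedComponentIn_subset _ _
  have hxS : x ∈ S := mem_connectedComponentIn hx
  have hconn : IsPreconnected S := isPreconnected_connectedComponentIn
  have hopen : IsOpen S := h.isOpen_diff.connectedComponentIn
  have hbb : BddBelow S := ⟨0, fun y hy => (h.subset_unit (hsub hy).1).1⟩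
  have hba : BddAbove S := ⟨1, fun y hy => (h.subset_unit (hsub hy).1).2⟩
  have hne : S.Nonempty := ⟨x, hxS⟩
  have hmax : ∀ U : Set ℝ, IsPreconnected U → S ⊆ U → U ⊆ A \ A₀ → U ⊆ S := fun U hU h1 h2 =>
    hU.subset_connectedComponentIn (h1 hxS) h2
  have hlt : ∀ y ∈ S, sInf S < y ∧ y < sSup S := by
    intro y hy
    obtain ⟨ε, hε, hb⟩ := Metric.isOpen_iff.1 hopen y hy
    have h1 : y - ε / 2 ∈ S := hb (by
      rw [Metric.mem_ball, Real.dist_eq, abs_lt]; constructor <;> linarith)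
    have h2 : y + ε / 2 ∈ S := hb (by
      rw [Metric.mem_ball, Real.dist_eq, abs_lt]; constructor <;> linarith)
    have h3 := csInf_le hbb h1
    have h4 := le_csSup hba h2
    constructor <;> linarith
  have hIoo : S = Ioo (sInf S) (sSup S) :=
    Subset.antisymm hlt (IsConnected.Ioo_csInf_csSup_subset ⟨hne, hconn⟩ hbb hba)
  have hlt' : sInf S < sSup S := (hlt x hxS).1.trans (hlt x hxS).2
  have hclA : closure S ⊆ A := closure_minimal (fun y hy => (hsub hy).1) h.isClosed
  refine ⟨hlt', hIoo, ?_, ?_⟩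
  · by_contra hcon
    have hm : sInf S ∈ A \ A₀ := ⟨hclA (csInf_mem_closure hne hbb), hcon⟩
    have : Ico (sInf S) (sSup S) ⊆ S := by
      refine hmax _ isPreconnected_Ico (fun y hy => ⟨(hlt y hy).1.le, (hlt y hy).2⟩) ?_
      intro y hy
      rcases hy.1.eq_or_lt with he | hl
      · exact he ▸ hm
      · exact hsub (hIoo ▸ (⟨hl, hy.2⟩ : y ∈ Ioo (sInf S) (sSup S)))
    exact lt_irrefl _ (hlt _ (this ⟨le_rfl, hlt'⟩)).1
  · by_contra hcon
    have hm : sSup S ∈ A \ A₀ := ⟨hclA (csSup_mem_closure hne hba), hcon⟩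
    have : Ioc (sInf S) (sSup S) ⊆ S := by
      refine hmax _ isPreconnected_Ioc (fun y hy => ⟨(hlt y hy).1, (hlt y hy).2.le⟩) ?_
      intro y hy
      rcases hy.2.eq_or_lt with he | hl
      · exact he ▸ hm
      · exact hsub (hIoo ▸ (⟨hy.1, hl⟩ : y ∈ Ioo (sInf S) (sSup S)))
    exact lt_irrefl _ (hlt _ (this ⟨hlt', le_rfl⟩)).2

/-- Distinct components are disjoint. -/
theorem gap_eq {i j : Gap A A₀} {x : ℝ} (hi : x ∈ i.1) (hj : x ∈ j.1) : i = j := by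
  obtain ⟨i, y, hy, rfl⟩ := i
  obtain ⟨j, z, hz, rfl⟩ := j
  refine Subtype.ext ?_
  simp only at hi hj ⊢
  rw [connectedComponentIn_eq hi, connectedComponentIn_eq hj]

theorem pos_fin_mem (n : ℤ) : 0 < (ZStar.fin n).pos ∧ (ZStar.fin n).pos < 1 := by
  have h1 : (0 : ℝ) < 1 + |(n : ℝ)| := by positivity
  have h2 : -1 < (n : ℝ) / (1 + |(n : ℝ)|) := by
    rw [lt_div_iff₀ h1]; linarith [neg_abs_le (n : ℝ)]
  have h3 : (n : ℝ) / (1 + |(n : ℝ)|) < 1 := by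
    rw [div_lt_one h1]; linarith [le_abs_self (n : ℝ)]
  simp only [ZStar.pos]
  constructor <;> linarith

theorem pos_fin_succ (n : ℤ) :
    (ZStar.fin n).pos < (ZStar.fin (n + 1)).pos ∧
    (ZStar.fin (n + 1)).pos ≤ 2 * (ZStar.fin n).pos ∧
    1 - (ZStar.fin n).pos ≤ 2 * (1 - (ZStar.fin (n + 1)).pos) := by
  simp only [ZStar.pos]
  push_cast
  rcases le_or_gt 0 n with hn | hn
  · have h0 : (0 : ℝ) ≤ n := by exact_mod_cast hn
    rw [abs_of_nonneg h0, abs_of_nonneg (by linarith : (0 : ℝ) ≤ n + 1)]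
    have e1 : (n : ℝ) / (1 + n) = 1 - 1 / (1 + n) := by field_simp; ring
    have e2 : ((n : ℝ) + 1) / (1 + (n + 1)) = 1 - 1 / (2 + n) := by field_simp; ring
    rw [e1, e2]
    have h1 : 1 / (2 + (n : ℝ)) < 1 / (1 + n) := by
      apply one_div_lt_one_div_of_lt <;> linarith
    have h2 : 1 / (1 + (n : ℝ)) ≤ 1 := by rw [div_le_one] <;> linarith
    have h3 : 0 < 1 / (2 + (n : ℝ)) := by positivity
    have h4 : 1 / (1 + (n : ℝ)) ≤ 2 * (1 / (2 + n)) := by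
      rw [div_le_iff₀ (by linarith)]
      field_simp
      linarith
    refine ⟨?_, ?_, ?_⟩ <;> linarith
  · have h0 : (n : ℝ) + 1 ≤ 0 := by exact_mod_cast hn
    rw [abs_of_nonpos (by linarith : (n : ℝ) ≤ 0), abs_of_nonpos h0]
    have p1 : (0 : ℝ) < 1 - n := by linarith
    have p2 : (0 : ℝ) < - n := by linarith
    have e1 : (n : ℝ) / (1 + -n) = 1 / (1 - n) - 1 := by
      rw [← sub_eq_add_neg]; field_simp; ring
    have e2 : ((n : ℝ) + 1) / (1 + -(n + 1)) = 1 / (-n) - 1 := by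
      rw [show (1 : ℝ) + -(n + 1) = -n by ring, eq_sub_iff_add_eq, div_add_one p2.ne']
      congr 1; ring
    rw [e1, e2]
    have h1 : 1 / (1 - (n : ℝ)) < 1 / (-n) := by
      apply one_div_lt_one_div_of_lt <;> linarith
    have h2 : 1 / (-(n : ℝ)) ≤ 1 := by rw [div_le_one p2]; linarith
    have h3 : 0 < 1 / (1 - (n : ℝ)) := by positivity
    have h4 : 1 / (-(n : ℝ)) ≤ 2 * (1 / (1 - n)) := by
      rw [mul_one_div, div_le_div_iff₀ p2 p1]
      linarith
    refine ⟨?_, ?_, ?_⟩ <;> linarith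

theorem pos_strictMono : StrictMono (fun n : ℤ => (ZStar.fin n).pos) :=
  strictMono_int_of_lt_succ fun n => (pos_fin_succ n).1

theorem abs_pos_shift_sub_le {k : ℤ} (hk : k = 1 ∨ k = -1) (n : ℤ) :
    |(ZStar.fin (n + k)).pos - (ZStar.fin n).pos| ≤ (ZStar.fin n).pos ∧
    |(ZStar.fin (n + k)).pos - (ZStar.fin n).pos| ≤ 1 - (ZStar.fin n).pos := by
  rcases hk with rfl | rfl
  · obtain ⟨h1, h2, h3⟩ := pos_fin_succ n
    have h4 := (pos_fin_mem (n + 1)).2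
    rw [abs_of_pos (by linarith)]
    constructor <;> linarith
  · obtain ⟨h1, h2, h3⟩ := pos_fin_succ (n + -1)
    rw [show n + -1 + 1 = n by ring] at h1 h2 h3
    have h4 := (pos_fin_mem (n + -1)).1
    rw [abs_of_neg (by linarith)]
    constructor <;> linarith

theorem q_mem_gap (h : SpiralPair A A₀) (j : Gap A A₀) (n : ℤ) :
    sInf j.1 + (sSup j.1 - sInf j.1) * (ZStar.fin n).pos ∈ j.1 := by
  obtain ⟨h1, h2, -, -⟩ := h.gap_spec j
  obtain ⟨h3, h4⟩ := pos_fin_mem n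
  have h5 : sInf j.1 + (sSup j.1 - sInf j.1) * (ZStar.fin n).pos ∈ Ioo (sInf j.1) (sSup j.1) := by
    constructor <;> nlinarith
  exact h2.symm.subset h5

/-- Every point of `Z(A, A₀)` is on an adding machine or is a wandering point of a spiral. -/
theorem Z_cases (h : SpiralPair A A₀) (z : Z A A₀) :
    (∃ a t, z = Quot.mk _ (.inr (a, t))) ∨
    (∃ j n, z = Quot.mk _ (.inl (j, ⟨(.fin n, (n : Theta)), Or.inr (Or.inr ⟨n, rfl, rfl⟩)⟩))) := by
  induction z using Quot.ind with
  | mk w =>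
    rcases w with ⟨j, ⟨⟨x, t⟩, hp⟩⟩ | ⟨a, t⟩
    · obtain ⟨-, -, h3, h4⟩ := h.gap_spec j
      rcases hp with hp | hp | ⟨n, hp, hp'⟩
      · simp only at hp; subst hp
        exact Or.inl ⟨⟨_, h3⟩, t, Quot.sound (Glue.left j _ t rfl)⟩
      · simp only at hp; subst hp
        exact Or.inl ⟨⟨_, h4⟩, t, Quot.sound (Glue.right j _ t rfl)⟩
      · simp only at hp hp'; subst hp hp'
        exact Or.inr ⟨j, n, rfl⟩
    · exact Or.inl ⟨a, t, rfl⟩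

theorem continuous_q : Continuous (q : Z A A₀ → ℝ) :=
  continuous_fst.comp (continuous_induced_dom (f := fun z : Z A A₀ => (q z, zeta z)))

theorem continuous_zeta : Continuous (zeta : Z A A₀ → Theta) :=
  continuous_snd.comp (continuous_induced_dom (f := fun z : Z A A₀ => (q z, zeta z)))

theorem zeta_shift (k : ℤ) (z : Z A A₀) : zeta (shift k z) = zeta z + (k : Theta) := by
  induction z using Quot.ind with
  | mk w => rcases w with ⟨j, p⟩ | ⟨a, t⟩ <;> rfl

theorem dist_q_shift_le (h : SpiralPair A A₀) {k : ℤ} (hk : k = 1 ∨ k = -1) (w : Z A A₀)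
    (a : ℝ) (ha : a ∈ A₀) : |q (shift k w) - a| ≤ 2 * |q w - a| := by
  rcases Z_cases h w with ⟨b, t, rfl⟩ | ⟨j, n, rfl⟩
  · change |(b : ℝ) - a| ≤ 2 * |(b : ℝ) - a|
    linarith [abs_nonneg ((b : ℝ) - a)]
  · change |sInf j.1 + (sSup j.1 - sInf j.1) * (ZStar.fin (n + k)).pos - a| ≤
      2 * |sInf j.1 + (sSup j.1 - sInf j.1) * (ZStar.fin n).pos - a|
    obtain ⟨h1, h2, -, -⟩ := h.gap_spec j
    obtain ⟨b1, b2⟩ := abs_pos_shift_sub_le hk n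
    obtain ⟨p1, p2⟩ := pos_fin_mem n
    set l := sInf j.1
    set r := sSup j.1
    set u := (ZStar.fin n).pos
    set v := (ZStar.fin (n + k)).pos
    have haj : a ≤ l ∨ r ≤ a := by
      by_contra! hc
      obtain ⟨x, hx, hj⟩ := j.2
      have : a ∈ j.1 := by rw [h2]; exact hc
      rw [hj] at this
      exact (connectedComponentIn_subset _ _ this).2 ha
    have tri : |l + (r - l) * v - a| ≤ |l + (r - l) * u - a| + (r - l) * |v - u| := by
      have e : l + (r - l) * v - a = (l + (r - l) * u - a) + (r - l) * (v - u) := by ring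
      rw [e]
      refine (abs_add_le _ _).trans ?_
      rw [abs_mul (r - l), abs_of_pos (by linarith : 0 < r - l)]
    have main : (r - l) * |v - u| ≤ |l + (r - l) * u - a| := by
      rcases haj with hl | hr
      · refine le_trans ?_ (le_abs_self _)
        nlinarith
      · refine le_trans ?_ (neg_le_abs _)
        nlinarith
    linarith

theorem continuous_shift (h : SpiralPair A A₀) {k : ℤ} (hk : k = 1 ∨ k = -1) :
    Continuous (shift k : Z A A₀ → Z A A₀) := by
  refine continuous_induced_rng.2 (Continuous.prodMk ?_ ?_)
  · refine continuous_iff_continuousAt.2 fun z => ?_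
    change Tendsto (fun w => q (shift k w)) (𝓝 z) (𝓝 (q (shift k z)))
    have hq : Tendsto (q : Z A A₀ → ℝ) (𝓝 z) (𝓝 (q z)) := continuous_q.tendsto z
    rcases Z_cases h z with ⟨a, t, rfl⟩ | ⟨j, n, rfl⟩
    · rw [tendsto_iff_dist_tendsto_zero] at hq ⊢
      have hq2 := hq.const_mul 2
      rw [mul_zero] at hq2
      exact squeeze_zero (fun _ => dist_nonneg) (fun w => dist_q_shift_le h hk w a a.2) hq2
    · obtain ⟨h1, h2, -, -⟩ := h.gap_spec j
      have hpos : 0 < sSup j.1 - sInf j.1 := by linarith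
      have hm := q_mem_gap h j n
      refine tendsto_const_nhds.congr' ?_
      have lo : sInf j.1 + (sSup j.1 - sInf j.1) * (ZStar.fin (n - 1)).pos <
          sInf j.1 + (sSup j.1 - sInf j.1) * (ZStar.fin n).pos := by
        have := mul_lt_mul_of_pos_left (pos_strictMono (show n - 1 < n by omega)) hpos
        simp only at this; linarith
      have hi : sInf j.1 + (sSup j.1 - sInf j.1) * (ZStar.fin n).pos <
          sInf j.1 + (sSup j.1 - sInf j.1) * (ZStar.fin (n + 1)).pos := by
        have := mul_lt_mul_of_pos_left (pos_strictMono (show n < n + 1 by omega)) hpos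
        simp only at this; linarith
      filter_upwards [hq.eventually (Ioo_mem_nhds lo hi)] with w hw
      have hwj : q w ∈ j.1 := by
        have m1 := q_mem_gap h j (n - 1)
        have m2 := q_mem_gap h j (n + 1)
        exact h2.symm.subset
          ⟨(h2.subset m1).1.trans hw.1, lt_trans hw.2 (h2.subset m2).2⟩
      rcases Z_cases h w with ⟨b, t, rfl⟩ | ⟨i, m, rfl⟩
      · exfalso
        obtain ⟨x, hx, hj⟩ := j.2
        rw [hj] at hwj
        exact (connectedComponentIn_subset _ _ hwj).2 b.2
      · obtain rfl : i = j := gap_eq (q_mem_gap h i m) hwj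
        have w1 : (ZStar.fin (n - 1)).pos < (ZStar.fin m).pos :=
          lt_of_mul_lt_mul_left (lt_of_add_lt_add_left hw.1) hpos.le
        have w2 : (ZStar.fin m).pos < (ZStar.fin (n + 1)).pos :=
          lt_of_mul_lt_mul_left (lt_of_add_lt_add_left hw.2) hpos.le
        have w3 := pos_strictMono.lt_iff_lt.1 w1
        have w4 := pos_strictMono.lt_iff_lt.1 w2
        obtain rfl : m = n := by omega
        rfl
  · simp only [zeta_shift]
    exact (continuous_induced_rng.2
      ((continuous_subtype_val.comp continuous_zeta).add continuous_const))

/-- The homeomorphism `τ_(A, A₀)` of `Z(A, A₀)`. -/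
noncomputable def tau (h : SpiralPair A A₀) : Z A A₀ ≃ₜ Z A A₀ where
  toFun := shift 1
  invFun := shift (-1)
  left_inv := shift_shift (by norm_num)
  right_inv := shift_shift (by norm_num)
  continuous_toFun := continuous_shift h (Or.inl rfl)
  continuous_invFun := continuous_shift h (Or.inr rfl)

/-- `X(A, A₀) = Z(A, A₀) × C` with `C` the classical Cantor set. -/
abbrev X (A A₀ : Set ℝ) : Type := Z A A₀ × cantorSet

/-- `T(A, A₀) = τ_(A, A₀) × 1_C`. -/
noncomputable def T (h : SpiralPair A A₀) : X A A₀ ≃ₜ X A A₀ :=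
  (tau h).prodCongr (Homeomorph.refl cantorSet)

end SpiralSpace

namespace SpiralSpace

/-! Two facts give the result. The first is that density of the conjugacy class follows from the
representation property on any Cantor space (`isDenseType_of_represents`). Given `S` and ε, take a
finite clopen partition `p` into cells that are small and have small `S`-images. The pairs of cells
joined by `S` form a surjective relation, which `T` represents by some `φ`. The fibers of `φ` and of
`p` are nonempty clopen subsets of a Cantor space, hence homeomorphic by Brouwer's theorem. Gluing
these homeomorphisms gives `H` with `p ∘ H = φ`, and then `H T H⁻¹` is ε-close to `S`. The space `X`
qualifies: `Z` is closed in `[0, 1] × Θ` and totally disconnected, and the factor `C` removes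
isolated points.

The second fact is that `T` represents every surjective relation `R` (`represents_T`). A pair `(a,
b)` of `R` extends to a bi-infinite `R`-path that is eventually periodic at both ends. Write this
path along the wandering orbit of one gap. A period `N` makes the two tails functions of the residue
mod `N`, which is defined on all of `Θ`, so the labelling extends continuously to everything on
either side of the gap (`exists_labelling`). A continuous map from `C` onto the finite set `R` then
selects which labelling to use, so that all pairs occur at once. -/

/-! ### Brouwer's characterization of the Cantor space -/

/-- In a totally disconnected compact Hausdorff space whose nonempty open sets are nontrivial,
every nonempty clopen set is cut into two nonempty clopen pieces, subordinate to a given clopen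
set. -/
theorem exists_clopen_split {Y : Type*} [TopologicalSpace Y] [CompactSpace Y] [T2Space Y]
    [TotallyDisconnectedSpace Y] (hY : ∀ D : Set Y, IsOpen D → D.Nonempty → D.Nontrivial)
    (D U : Set Y) (hD : IsClopen D ∧ D.Nonempty) (hU : IsClopen U) :
    ∃ E ⊆ D, (IsClopen E ∧ E.Nonempty) ∧ (IsClopen (D \ E) ∧ (D \ E).Nonempty) ∧
      (E ⊆ U ∨ Disjoint E U) ∧ (D \ E ⊆ U ∨ Disjoint (D \ E) U) := by
  by_cases h : (D ∩ U).Nonempty ∧ (D \ U).Nonempty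
  · refine ⟨D ∩ U, inter_subset_left, ⟨hD.1.inter hU, h.1⟩, ?_, Or.inl inter_subset_right, ?_⟩
    · rw [sdiff_self_inter]
      exact ⟨hD.1.diff hU, h.2⟩
    · rw [sdiff_self_inter]
      exact Or.inr disjoint_sdiff_left
  · have hdec : D ⊆ U ∨ Disjoint D U := by
      rw [not_and_or, not_nonempty_iff_eq_empty, not_nonempty_iff_eq_empty] at h
      rcases h with h | h
      · exact Or.inr (disjoint_iff_inter_eq_empty.2 h)
      · exact Or.inl (sdiff_eq_empty.1 h)
    obtain ⟨x, hx, y, hy, hxy⟩ := hY D hD.1.isOpen hD.2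
    obtain ⟨V, hV, hxV, hyV⟩ := exists_isClopen_of_totally_separated hxy
    refine ⟨D ∩ V, inter_subset_left, ⟨hD.1.inter hV, x, hx, hxV⟩, ?_, ?_, ?_⟩
    · rw [sdiff_self_inter]
      exact ⟨hD.1.diff hV, y, hy, hyV⟩
    · exact hdec.imp inter_subset_left.trans (Disjoint.mono_left inter_subset_left)
    · exact hdec.imp sdiff_subset.trans (Disjoint.mono_left sdiff_subset)

section Tree

variable {Y : Type*} (split : Set Y → ℕ → Set Y)

/-- The cell of level `n` along the branch `s` of the tree of successive splittings. -/
def branchCell (s : ℕ → Bool) : ℕ → Set Y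
  | 0 => univ
  | n + 1 => bif s n then split (branchCell s n) n else branchCell s n \ split (branchCell s n) n

open Classical in
/-- The cell of level `n` around a point in the tree of successive splittings. -/
noncomputable def pointCell (x : Y) : ℕ → Set Y
  | 0 => univ
  | n + 1 => if x ∈ split (pointCell x n) n then split (pointCell x n) n
      else pointCell x n \ split (pointCell x n) n

open Classical in
/-- The branch of the tree of successive splittings that contains a point. -/
noncomputable def address (x : Y) (n : ℕ) : Bool := decide (x ∈ split (pointCell split x n) n)

theorem mem_pointCell (x : Y) (n : ℕ) : x ∈ pointCell split x n := by
  induction n with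
  | zero => trivial
  | succ n ih =>
    rw [pointCell]
    split_ifs with h
    · exact h
    · exact ⟨ih, h⟩

theorem branchCell_address (x : Y) (n : ℕ) :
    branchCell split (address split x) n = pointCell split x n := by
  induction n with
  | zero => rfl
  | succ n ih =>
    rw [branchCell, pointCell, ih, address]
    split_ifs with h <;> simp [h]

theorem branchCell_succ_subset {split : Set Y → ℕ → Set Y}
    (hs : ∀ s n, split (branchCell split s n) n ⊆ branchCell split s n) (s : ℕ → Bool) (n : ℕ) :
    branchCell split s (n + 1) ⊆ branchCell split s n := by
  rw [branchCell]
  cases s n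
  · exact sdiff_subset
  · exact hs s n

-- Since `split` is arbitrary here, the cells need not be nested, so membership is required at every
-- level up to `n`.
open Classical in
theorem pointCell_eq_of_mem {s : ℕ → Bool} {x : Y} {n : ℕ}
    (hx : ∀ k ≤ n, x ∈ branchCell split s k) : pointCell split x n = branchCell split s n := by
  induction n with
  | zero => rfl
  | succ n ih =>
    have ih' := ih fun k hk => hx k (by omega)
    have hn := hx (n + 1) le_rfl
    rw [branchCell] at hn
    rw [pointCell, branchCell, ih']
    cases hsn : s n
    · rw [hsn] at hn
      exact if_neg hn.2
    · rw [hsn] at hn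
      exact if_pos hn

open Classical in
theorem address_eq_of_mem {s : ℕ → Bool} {x : Y} {n : ℕ}
    (hx : ∀ k ≤ n + 1, x ∈ branchCell split s k) : address split x n = s n := by
  have hn := hx (n + 1) le_rfl
  rw [branchCell] at hn
  rw [address, pointCell_eq_of_mem split fun k hk => hx k (by omega)]
  cases hsn : s n
  · rw [hsn] at hn
    exact decide_eq_false hn.2
  · rw [hsn] at hn
    exact decide_eq_true hn

end Tree

/-- Brouwer: a nonempty totally disconnected compact metrizable space whose nonempty open sets
are nontrivial is homeomorphic to the Cantor space. -/
theorem nonempty_homeomorph_cantor {Y : Type*} [TopologicalSpace Y] [CompactSpace Y] [T2Space Y]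
    [TotallyDisconnectedSpace Y] [SecondCountableTopology Y] [Nonempty Y]
    (hY : ∀ D : Set Y, IsOpen D → D.Nonempty → D.Nontrivial) : Nonempty (Y ≃ₜ (ℕ → Bool)) := by
  classical
  -- Enumerating all clopen sets and splitting level `n` subordinately to `U n` ensures that the
  -- cells along a branch eventually separate points.
  have : Countable (TopologicalSpace.Clopens Y) :=
    TopologicalSpace.Clopens.countable_iff_secondCountable.2 inferInstance
  obtain ⟨U, hU⟩ := exists_surjective_nat (TopologicalSpace.Clopens Y)
  choose! E hE using fun (D : Set Y) (n : ℕ) (hD : IsClopen D ∧ D.Nonempty) =>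
    exists_clopen_split hY D (U n) hD (U n).isClopen
  have hcell : ∀ s n, IsClopen (branchCell E s n) ∧ (branchCell E s n).Nonempty := by
    intro s n
    induction n with
    | zero => exact ⟨isClopen_univ, univ_nonempty⟩
    | succ n ih =>
      rw [branchCell]
      cases s n
      · exact (hE _ n ih).2.2.1
      · exact (hE _ n ih).2.1
  have hanti : ∀ s n, branchCell E s (n + 1) ⊆ branchCell E s n :=
    branchCell_succ_subset fun s n => (hE _ n (hcell s n)).1
  have hdec : ∀ s n, branchCell E s (n + 1) ⊆ U n ∨ Disjoint (branchCell E s (n + 1)) (U n) := by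
    intro s n
    rw [branchCell]
    cases s n
    · exact (hE _ n (hcell s n)).2.2.2.2
    · exact (hE _ n (hcell s n)).2.2.2.1
  have hinj : Function.Injective (address E) := by
    intro x y hxy
    by_contra hne
    obtain ⟨V, hV, hxV, hyV⟩ := exists_isClopen_of_totally_separated hne
    obtain ⟨n, hn⟩ := hU ⟨V, hV⟩
    have hx := mem_pointCell E x (n + 1)
    have hy := mem_pointCell E y (n + 1)
    rw [← branchCell_address] at hx hy
    rw [← hxy] at hy
    have hd := hdec (address E x) n
    rw [hn] at hd
    rcases hd with hd | hd
    · exact hyV (hd hy)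
    · exact disjoint_left.1 hd hx hxV
  have hsurj : Function.Surjective (address E) := by
    intro s
    obtain ⟨x, hx⟩ := IsCompact.nonempty_iInter_of_sequence_nonempty_isCompact_isClosed
      (branchCell E s) (hanti s) (fun n => (hcell s n).2) (hcell s 0).1.isClosed.isCompact
      (fun n => (hcell s n).1.isClosed)
    rw [mem_iInter] at hx
    exact ⟨x, funext fun n => address_eq_of_mem E fun k _ => hx k⟩
  have hcont : Continuous (address E) := by
    refine continuous_pi fun n => continuous_iff_continuousAt.2 fun x => ?_
    have hx := mem_pointCell E x (n + 1)
    rw [← branchCell_address] at hx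
    refine tendsto_const_nhds.congr' ?_
    filter_upwards [(hcell (address E x) (n + 1)).1.isOpen.mem_nhds hx] with y hy
    have hmono : Antitone (branchCell E (address E x)) := antitone_nat_of_succ_le (hanti _)
    exact (address_eq_of_mem E fun k hk => hmono hk hy).symm
  exact ⟨hcont.homeoOfEquivCompactToT2 (f := Equiv.ofBijective _ ⟨hinj, hsurj⟩)⟩

/-- Any two nonempty clopen subsets of a Cantor space are homeomorphic. -/
theorem nonempty_homeomorph_clopen {Y : Type*} [TopologicalSpace Y] [CompactSpace Y] [T2Space Y]
    [TotallyDisconnectedSpace Y] [SecondCountableTopology Y]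
    (hY : ∀ D : Set Y, IsOpen D → D.Nonempty → D.Nontrivial) {U V : Set Y}
    (hU : IsClopen U) (hV : IsClopen V) (hU' : U.Nonempty) (hV' : V.Nonempty) :
    Nonempty (U ≃ₜ V) := by
  have key : ∀ U : Set Y, IsClopen U → U.Nonempty → Nonempty (U ≃ₜ (ℕ → Bool)) := by
    intro U hU hU'
    have := isCompact_iff_compactSpace.1 hU.isClosed.isCompact
    have := hU'.to_subtype
    refine nonempty_homeomorph_cantor fun D hD hD' => ?_
    have := hY (Subtype.val '' D) (hU.isOpen.isOpenMap_subtype_val D hD) (hD'.image _)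
    exact (image_nontrivial Subtype.val_injective).1 this
  obtain ⟨e⟩ := key U hU hU'
  obtain ⟨f⟩ := key V hV hV'
  exact ⟨e.trans f.symm⟩

/-! ### Dense type from representation of relations -/

/-- A compact totally disconnected space has finite clopen partitions on whose members a given
continuous map has small oscillation. -/
theorem exists_finite_partition {Y M : Type*} [TopologicalSpace Y] [CompactSpace Y] [T2Space Y]
    [TotallyDisconnectedSpace Y] [PseudoMetricSpace M] {g : Y → M} (hg : Continuous g) {ε : ℝ}
    (hε : 0 < ε) :
    ∃ (n : ℕ) (W : Set (Fin n → Prop)) (p : Y → W), IsLocallyConstant p ∧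
      Function.Surjective p ∧ ∀ x y, p x = p y → dist (g x) (g y) < ε := by
  have hV : ∀ x : Y, ∃ V : Set Y, IsClopen V ∧ x ∈ V ∧ V ⊆ g ⁻¹' Metric.ball (g x) (ε / 2) :=
    fun x => compact_exists_isClopen_in_isOpen (Metric.isOpen_ball.preimage hg)
      (Metric.mem_ball_self (half_pos hε))
  choose V hVc hVx hVs using hV
  obtain ⟨t, ht⟩ := isCompact_univ.elim_finite_subcover V (fun x => (hVc x).isOpen)
    (fun x _ => mem_iUnion.2 ⟨x, hVx x⟩)
  let e := t.equivFin
  -- The parts are the atoms generated by the finite cover: a point is labelled by the members that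
  -- contain it.
  let f : Y → Fin t.card → Prop := fun y i => y ∈ V (e.symm i)
  have hf : IsLocallyConstant f := by
    rw [IsLocallyConstant.iff_eventually_eq]
    intro x
    have : ∀ i, ∀ᶠ y in 𝓝 x, f y i = f x i := by
      intro i
      by_cases hx : x ∈ V (e.symm i)
      · filter_upwards [(hVc (e.symm i)).isOpen.mem_nhds hx] with y hy
        exact propext ⟨fun _ => hx, fun _ => hy⟩
      · filter_upwards [(hVc (e.symm i)).compl.isOpen.mem_nhds hx] with y hy
        exact propext ⟨fun h => absurd h hy, fun h => absurd h hx⟩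
    filter_upwards [eventually_all.2 this] with y hy
    exact funext hy
  refine ⟨t.card, range f, rangeFactorization f, ?_, rangeFactorization_surjective, ?_⟩
  · rw [IsLocallyConstant.iff_eventually_eq] at hf ⊢
    exact fun x => (hf x).mono fun y hy => Subtype.ext hy
  · intro x y hxy
    obtain ⟨z, hz, hxz⟩ := mem_iUnion₂.1 (ht (mem_univ x))
    have hfx : f x (e ⟨z, hz⟩) := by
      change x ∈ V (e.symm (e ⟨z, hz⟩))
      rwa [e.symm_apply_apply]
    have hfy : f y (e ⟨z, hz⟩) := by
      have := congrFun (congrArg Subtype.val hxy) (e ⟨z, hz⟩)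
      exact this.mp hfx
    have hyz : y ∈ V z := by
      change y ∈ V (e.symm (e ⟨z, hz⟩)) at hfy
      rwa [e.symm_apply_apply] at hfy
    have h1 : dist (g x) (g z) < ε / 2 := hVs z hxz
    have h2 : dist (g y) (g z) < ε / 2 := hVs z hyz
    linarith [dist_triangle_right (g x) (g y) (g z)]

/-- Homeomorphisms between the fibers of two continuous maps to a discrete space fit together. -/
theorem exists_homeomorph_of_fibers {Y W : Type*} [TopologicalSpace Y] [TopologicalSpace W]
    [DiscreteTopology W] {φ p : Y → W} (hφ : Continuous φ) (hp : Continuous p)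
    (e : ∀ a, Nonempty (φ ⁻¹' {a} ≃ₜ p ⁻¹' {a})) : ∃ H : Y ≃ₜ Y, ∀ x, p (H x) = φ x := by
  have e := fun a => (e a).some
  have glue : ∀ {φ p : Y → W}, Continuous φ → ∀ e : (∀ a, φ ⁻¹' {a} ≃ₜ p ⁻¹' {a}),
      Continuous fun x => (e (φ x) ⟨x, rfl⟩ : Y) := by
    intro φ p hφ e
    refine continuous_iff_continuousAt.2 fun x => ?_
    have ho : IsOpen (φ ⁻¹' {φ x}) := (isOpen_discrete _).preimage hφ
    refine ContinuousOn.continuousAt (s := φ ⁻¹' {φ x}) ?_ (ho.mem_nhds rfl)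
    rw [continuousOn_iff_continuous_domRestrict]
    refine (continuous_subtype_val.comp (e (φ x)).continuous).congr ?_
    rintro ⟨y, hy : φ y = φ x⟩
    simp only [domRestrict_apply, Function.comp_apply]
    have : ∀ (a : W) (h : φ y = a), (e a ⟨y, h⟩ : Y) = e (φ y) ⟨y, rfl⟩ := by
      rintro _ rfl; rfl
    exact this _ hy
  have hmem : ∀ x, p (e (φ x) ⟨x, rfl⟩) = φ x := fun x => (e (φ x) ⟨x, rfl⟩).2
  have hmem' : ∀ y, φ ((e (p y)).symm ⟨y, rfl⟩) = p y := fun y => ((e (p y)).symm ⟨y, rfl⟩).2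
  refine ⟨⟨⟨fun x => e (φ x) ⟨x, rfl⟩, fun y => (e (p y)).symm ⟨y, rfl⟩, ?_, ?_⟩, glue hφ e,
    glue hp fun a => (e a).symm⟩, hmem⟩
  · intro x
    -- Fibers over labels that are only provably equal are different types; a variable label `a` can
    -- be substituted.
    have : ∀ (a : W) (h : p (e (φ x) ⟨x, rfl⟩) = a) (_ : a = φ x),
        ((e a).symm ⟨e (φ x) ⟨x, rfl⟩, h⟩ : Y) = x := by
      rintro _ h rfl
      exact congrArg Subtype.val ((e (φ x)).symm_apply_apply ⟨x, rfl⟩)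
    exact this _ rfl (hmem x)
  · intro y
    have : ∀ (a : W) (h : φ ((e (p y)).symm ⟨y, rfl⟩) = a) (_ : a = p y),
        (e a ⟨(e (p y)).symm ⟨y, rfl⟩, h⟩ : Y) = y := by
      rintro _ h rfl
      exact congrArg Subtype.val ((e (p y)).apply_symm_apply ⟨y, rfl⟩)
    exact this _ rfl (hmem' y)

/-- A homeomorphism of a Cantor space which represents all surjective relations on finite sets is
of dense type. -/
theorem isDenseType_of_represents {Y : Type*} [TopologicalSpace Y] [CompactSpace Y] [T2Space Y]
    [TotallyDisconnectedSpace Y] [SecondCountableTopology Y] [Nonempty Y]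
    (hY : ∀ D : Set Y, IsOpen D → D.Nonempty → D.Nontrivial) (T : Y ≃ₜ Y)
    (hT : ∀ (W : Type) [Finite W] [Nonempty W] [TopologicalSpace W] [DiscreteTopology W]
      (R : W → W → Prop), IsSurjectiveRelation R → Represents T R) : IsDenseType T := by
  refine eq_univ_of_forall fun S => ?_
  let := TopologicalSpace.metrizableSpaceMetric Y
  have hind : IsInducing (fun h : Y ≃ₜ Y => (h : C(Y, Y))) := ⟨rfl⟩
  rw [hind.closure_eq_preimage_closure_image, mem_preimage, Metric.mem_closure_iff]
  intro ε hε
  obtain ⟨n, W, p, hp, hps, hpε⟩ := exists_finite_partition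
    (continuous_id.prodMk S.continuous : Continuous fun y => (y, S y)) (half_pos hε)
  let : TopologicalSpace W := ⊥
  have : DiscreteTopology W := ⟨rfl⟩
  have : Nonempty W := ⟨p (Classical.arbitrary Y)⟩
  obtain ⟨φ, hφ, hφs, hR⟩ := hT W (fun a b => ∃ y, p y = a ∧ p (S y) = b) (by
    constructor
    · intro a
      obtain ⟨y, rfl⟩ := hps a
      exact ⟨_, y, rfl, rfl⟩
    · intro b
      obtain ⟨y, rfl⟩ := hps b
      exact ⟨_, S.symm y, rfl, by rw [S.apply_symm_apply]⟩)
  obtain ⟨H, hH⟩ := exists_homeomorph_of_fibers hφ hp.continuous fun a =>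
    nonempty_homeomorph_clopen hY ((isClopen_discrete {a}).preimage hφ)
      ((isClopen_discrete {a}).preimage hp.continuous)
      ((singleton_nonempty a).preimage hφs) ((singleton_nonempty a).preimage hps)
  refine ⟨_, ⟨_, ⟨H, rfl⟩, rfl⟩, (ContinuousMap.dist_lt_iff hε).2 fun y => ?_⟩
  change dist (S y) (H (T (H.symm y))) < ε
  obtain ⟨x, rfl⟩ := H.surjective y
  rw [H.symm_apply_apply]
  -- `y'` shares a cell with `H x`, and `S y'` shares a cell with `H (T x)`. The first makes `S (H
  -- x)` close to `S y'`, the second makes `S y'` close to `H (T x)`.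
  obtain ⟨y', h1, h2⟩ := (hR (φ x) (φ (T x))).2 ⟨x, rfl, rfl⟩
  have d1 := hpε (H x) y' (by rw [hH, h1])
  have d2 := hpε (S y') (H (T x)) (by rw [hH, h2])
  rw [Prod.dist_eq, max_lt_iff] at d1 d2
  have d3 : dist (S (H x)) (S y') < ε / 2 := d1.2
  have d4 : dist (S y') (H (T x)) < ε / 2 := d2.1
  linarith [dist_triangle (S (H x)) (S y') (H (T x))]

variable {A A₀ : Set ℝ}

/-! ### The topology of the space of spirals -/

instance : CompactSpace Theta := by
  have hc : IsClosed (thetaSubring : Set (∀ m : ℕ+, ZMod (m : ℕ))) := by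
    change IsClosed {f : ∀ m : ℕ+, ZMod (m : ℕ) |
      ∀ (m n : ℕ+) (h : (m : ℕ) ∣ (n : ℕ)), ZMod.castHom h (ZMod (m : ℕ)) (f n) = f m}
    simp only [ofPred_forall]
    exact isClosed_iInter fun m => isClosed_iInter fun n => isClosed_iInter fun h =>
      isClosed_eq (continuous_of_discreteTopology.comp (continuous_apply n)) (continuous_apply m)
  exact isCompact_iff_compactSpace.1 hc.isCompact

instance : SecondCountableTopology Theta := by
  have : ∀ m : ℕ+, SecondCountableTopology (ZMod (m : ℕ)) := fun m =>
    Finite.toSecondCountableTopology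
  exact TopologicalSpace.Subtype.secondCountableTopology _

/-- The position in `[0, 1]` of the `n`-th wandering point in the gap `j`. -/
noncomputable def gapPoint (j : Gap A A₀) (n : ℤ) : ℝ :=
  sInf j.1 + (sSup j.1 - sInf j.1) * (ZStar.fin n).pos

/-- The `n`-th wandering point in the gap `j`. -/
def wandering (j : Gap A A₀) (n : ℤ) : Z A A₀ :=
  Quot.mk _ (.inl (j, ⟨(.fin n, (n : Theta)), Or.inr (Or.inr ⟨n, rfl, rfl⟩)⟩))

/-- The point `(a, t)` of the adding machine over `a`. -/
def adding (a : A₀) (t : Theta) : Z A A₀ := Quot.mk _ (.inr (a, t))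

theorem q_wandering (j : Gap A A₀) (n : ℤ) : q (wandering j n) = gapPoint j n := rfl

theorem zeta_wandering (j : Gap A A₀) (n : ℤ) : zeta (wandering j n) = (n : Theta) := rfl

theorem q_adding (a : A₀) (t : Theta) : q (adding a t : Z A A₀) = a := rfl

theorem zeta_adding (a : A₀) (t : Theta) : zeta (adding a t : Z A A₀) = t := rfl

theorem shift_wandering (k : ℤ) (j : Gap A A₀) (n : ℤ) :
    shift k (wandering j n) = wandering j (n + k) := by
  refine congrArg (Quot.mk _) (congrArg Sum.inl (Prod.ext rfl (Subtype.ext (Prod.ext rfl ?_))))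
  exact (Int.cast_add n k).symm

theorem eq_adding_or_wandering (h : SpiralPair A A₀) (z : Z A A₀) :
    (∃ a t, z = adding a t) ∨ ∃ j n, z = wandering j n := Z_cases h z

theorem gapPoint_mem (h : SpiralPair A A₀) (j : Gap A A₀) (n : ℤ) : gapPoint j n ∈ j.1 :=
  q_mem_gap h j n

theorem Gap.subset (j : Gap A A₀) : j.1 ⊆ A \ A₀ := by
  obtain ⟨_, x, -, rfl⟩ := j
  exact connectedComponentIn_subset _ _

theorem Gap.ordConnected (h : SpiralPair A A₀) (j : Gap A A₀) : OrdConnected j.1 := by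
  rw [(h.gap_spec j).2.1]
  exact ordConnected_Ioo

theorem gapPoint_strictMono (h : SpiralPair A A₀) (j : Gap A A₀) : StrictMono (gapPoint j) := by
  intro m n hmn
  have := mul_lt_mul_of_pos_left (pos_strictMono hmn) (sub_pos.2 (h.gap_spec j).1)
  exact add_lt_add_right this _

/-- The points over a gap are the wandering points in that gap. -/
theorem eq_wandering_of_q_mem (h : SpiralPair A A₀) {z : Z A A₀} {j : Gap A A₀}
    (hz : q z ∈ j.1) : ∃ n, z = wandering j n := by
  rcases eq_adding_or_wandering h z with ⟨a, t, rfl⟩ | ⟨i, n, rfl⟩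
  · exact absurd a.2 (j.subset hz).2
  · obtain rfl : i = j := gap_eq (gapPoint_mem h i n) hz
    exact ⟨n, rfl⟩

theorem q_mem (h : SpiralPair A A₀) (z : Z A A₀) : q z ∈ A := by
  rcases eq_adding_or_wandering h z with ⟨a, t, rfl⟩ | ⟨j, n, rfl⟩
  · exact h.subset a.2
  · exact (j.subset (gapPoint_mem h j n)).1

/-- There are no points between consecutive points of a wandering orbit. -/
theorem q_notMem_Ioo (h : SpiralPair A A₀) (z : Z A A₀) (j : Gap A A₀) (n : ℤ) :
    q z ∉ Ioo (gapPoint j n) (gapPoint j (n + 1)) := by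
  intro hz
  have hj := (Gap.ordConnected h j).out (gapPoint_mem h j n) (gapPoint_mem h j (n + 1))
    (Ioo_subset_Icc_self hz)
  obtain ⟨m, rfl⟩ := eq_wandering_of_q_mem h hj
  have h1 := (gapPoint_strictMono h j).lt_iff_lt.1 hz.1
  have h2 := (gapPoint_strictMono h j).lt_iff_lt.1 hz.2
  omega

theorem injective_q_zeta (h : SpiralPair A A₀) :
    Function.Injective fun z : Z A A₀ => (q z, zeta z) := by
  intro z w hzw
  obtain ⟨h1, h2⟩ := Prod.ext_iff.1 hzw
  simp only at h1 h2
  rcases eq_adding_or_wandering h z with ⟨a, t, rfl⟩ | ⟨j, n, rfl⟩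
  · rcases eq_adding_or_wandering h w with ⟨b, s, rfl⟩ | ⟨i, m, rfl⟩
    · rw [q_adding, q_adding] at h1
      rw [zeta_adding, zeta_adding] at h2
      rw [Subtype.ext h1, h2]
    · have := (i.subset (gapPoint_mem h i m)).2
      rw [q_adding, q_wandering] at h1
      exact absurd (h1 ▸ a.2) this
  · rw [q_wandering] at h1
    obtain ⟨m, rfl⟩ := eq_wandering_of_q_mem h (h1 ▸ gapPoint_mem h j n)
    rw [(gapPoint_strictMono h j).injective h1]

theorem isEmbedding_q_zeta (h : SpiralPair A A₀) :
    IsEmbedding fun z : Z A A₀ => (q z, zeta z) :=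
  ⟨⟨rfl⟩, injective_q_zeta h⟩

/-- The positions accumulate at 0 and at 1, so the integers with position at most `u` have a
greatest element. -/
theorem exists_pos_le_lt {u : ℝ} (h0 : 0 < u) (h1 : u < 1) :
    ∃ n : ℤ, (ZStar.fin n).pos ≤ u ∧ u < (ZStar.fin (n + 1)).pos := by
  have lo : ∃ n : ℤ, (ZStar.fin n).pos ≤ u := by
    obtain ⟨n, hn⟩ := exists_nat_gt (1 / u)
    refine ⟨-n, ?_⟩
    have hn0 : (0 : ℝ) ≤ n := n.cast_nonneg
    simp only [ZStar.pos, Int.cast_neg, Int.cast_natCast, abs_neg, abs_of_nonneg hn0]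
    rw [div_lt_iff₀ h0] at hn
    rw [div_le_iff₀ (by norm_num), show (1 : ℝ) + -(n : ℝ) / (1 + n) = 1 / (1 + n) by
      field_simp; ring, div_le_iff₀ (by positivity)]
    nlinarith
  have hi : ∃ n : ℤ, u < (ZStar.fin n).pos := by
    obtain ⟨n, hn⟩ := exists_nat_gt (1 / (1 - u))
    refine ⟨n, ?_⟩
    have hn0 : (0 : ℝ) ≤ n := n.cast_nonneg
    simp only [ZStar.pos, Int.cast_natCast, abs_of_nonneg hn0]
    rw [div_lt_iff₀ (by linarith)] at hn
    rw [lt_div_iff₀ (by norm_num), show (1 : ℝ) + (n : ℝ) / (1 + n) = (1 + 2 * n) / (1 + n) by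
      field_simp; ring, lt_div_iff₀ (by positivity)]
    nlinarith
  obtain ⟨b, hb⟩ := hi
  obtain ⟨n, hn, hmax⟩ := Int.exists_greatest_of_bdd (P := fun n => (ZStar.fin n).pos ≤ u)
    ⟨b, fun z hz => (pos_strictMono.lt_iff_lt.1 (lt_of_le_of_lt hz hb)).le⟩ lo
  refine ⟨n, hn, lt_of_not_ge fun hc => ?_⟩
  have := hmax _ hc
  omega

theorem exists_gapPoint_le_lt (h : SpiralPair A A₀) (j : Gap A A₀) {x : ℝ} (hx : x ∈ j.1) :
    ∃ n : ℤ, gapPoint j n ≤ x ∧ x < gapPoint j (n + 1) := by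
  obtain ⟨h1, h2, -, -⟩ := h.gap_spec j
  have hx' := h2.subset hx
  have hpos : 0 < sSup j.1 - sInf j.1 := sub_pos.2 h1
  obtain ⟨n, hn1, hn2⟩ := exists_pos_le_lt (u := (x - sInf j.1) / (sSup j.1 - sInf j.1))
    (div_pos (sub_pos.2 hx'.1) hpos) ((div_lt_one hpos).2 (by linarith [hx'.2]))
  rw [le_div_iff₀ hpos] at hn1
  rw [div_lt_iff₀ hpos] at hn2
  refine ⟨n, ?_, ?_⟩ <;> unfold gapPoint <;> linarith

/-- Over `A₀` the image contains the whole fiber `Θ`. A point off the image is thus outside `A`,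
strictly between consecutive positions of a gap, or at a position with the wrong `Θ`-coordinate;
each case is an open condition near the point. -/
theorem isClosed_range_q_zeta (h : SpiralPair A A₀) :
    IsClosed (range fun z : Z A A₀ => (q z, zeta z)) := by
  rw [← isOpen_compl_iff, isOpen_iff_mem_nhds]
  rintro ⟨x, t⟩ hxt
  by_cases hA : x ∈ A
  · have hA₀ : x ∉ A₀ := fun hx => hxt ⟨adding ⟨x, hx⟩ t, rfl⟩
    obtain ⟨j, hxj⟩ : ∃ j : Gap A A₀, x ∈ j.1 :=
      ⟨⟨_, x, ⟨hA, hA₀⟩, rfl⟩, mem_connectedComponentIn ⟨hA, hA₀⟩⟩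
    obtain ⟨n, hn, hn'⟩ := exists_gapPoint_le_lt h j hxj
    rcases hn.eq_or_lt with rfl | hn
    · have ht : t ≠ (n : Theta) := by
        rintro rfl
        exact hxt ⟨wandering j n, rfl⟩
      have hlt := gapPoint_strictMono h j (show n - 1 < n by omega)
      filter_upwards [prod_mem_nhds (Ioo_mem_nhds hlt hn') (isOpen_ne.mem_nhds ht)]
      rintro _ ⟨h1, h2⟩ ⟨z, rfl⟩
      rcases lt_trichotomy (q z) (gapPoint j n) with hz | hz | hz
      · exact q_notMem_Ioo h z j (n - 1) ⟨h1.1, by rwa [sub_add_cancel]⟩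
      · have hzj : q z ∈ j.1 := hz ▸ gapPoint_mem h j n
        obtain ⟨m, rfl⟩ := eq_wandering_of_q_mem h hzj
        rw [q_wandering] at hz
        obtain rfl := (gapPoint_strictMono h j).injective hz
        exact h2 rfl
      · exact q_notMem_Ioo h z j n ⟨hz, h1.2⟩
    · filter_upwards [prod_mem_nhds (Ioo_mem_nhds hn hn') univ_mem]
      rintro _ ⟨h1, -⟩ ⟨z, rfl⟩
      exact q_notMem_Ioo h z j n h1
  · filter_upwards [prod_mem_nhds (h.isClosed.isOpen_compl.mem_nhds hA) univ_mem]
    rintro _ ⟨h1, -⟩ ⟨z, rfl⟩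
    exact h1 (q_mem h z)

theorem compactSpace_Z (h : SpiralPair A A₀) : CompactSpace (Z A A₀) := by
  refine ⟨(isEmbedding_q_zeta h).isInducing.isCompact_iff.2 ?_⟩
  rw [image_univ]
  refine (isCompact_Icc.prod isCompact_univ : IsCompact (Icc (0 : ℝ) 1 ×ˢ (univ : Set Theta)))
    |>.of_isClosed_subset (isClosed_range_q_zeta h) ?_
  rintro _ ⟨z, rfl⟩
  exact ⟨h.subset_unit (q_mem h z), trivial⟩

/-- If `q` took two values on a connected set, it would take all values between them. As `A₀` is
nowhere dense, one of these is a wandering position, and just after it there are values that `q`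
omits. -/
theorem totallyDisconnectedSpace_Z (h : SpiralPair A A₀) : TotallyDisconnectedSpace (Z A A₀) := by
  refine ⟨fun S _ hS z hz w hw => injective_q_zeta h (Prod.ext ?_ ?_)⟩
  · have hord : OrdConnected (q '' S) := (hS.image q continuous_q.continuousOn).ordConnected
    have key : ∀ u ∈ q '' S, ∀ v ∈ q '' S, ¬ u < v := by
      intro u hu v hv huv
      have hsub : Ioo u v ⊆ q '' S := Ioo_subset_Icc_self.trans (hord.out hu hv)
      have hnot : ¬ Ioo u v ⊆ A₀ := by
        intro hc
        have := interior_maximal hc isOpen_Ioo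
        rw [h.isClosed₀.isNowhereDense_iff.1 h.nowhereDense] at this
        exact (nonempty_Ioo.2 huv).not_subset_empty this
      obtain ⟨x, hx, hxA⟩ := not_subset.1 hnot
      obtain ⟨y, -, rfl⟩ := hsub hx
      rcases eq_adding_or_wandering h y with ⟨a, t, rfl⟩ | ⟨j, n, rfl⟩
      · exact hxA a.2
      · rw [q_wandering] at hx
        have hlt : gapPoint j n < min v (gapPoint j (n + 1)) :=
          lt_min hx.2 (gapPoint_strictMono h j (lt_add_one n))
        obtain ⟨y, hy1, hy2⟩ := exists_between hlt
        obtain ⟨z, -, rfl⟩ := hsub ⟨hx.1.trans hy1, hy2.trans_le (min_le_left _ _)⟩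
        exact q_notMem_Ioo h z j n ⟨hy1, hy2.trans_le (min_le_right _ _)⟩
    exact le_antisymm (not_lt.1 (key _ ⟨w, hw, rfl⟩ _ ⟨z, hz, rfl⟩))
      (not_lt.1 (key _ ⟨z, hz, rfl⟩ _ ⟨w, hw, rfl⟩))
  · exact (hS.image zeta continuous_zeta.continuousOn).subsingleton ⟨z, hz, rfl⟩ ⟨w, hw, rfl⟩

/-! ### Absence of isolated points, and reduction to representing relations -/

theorem nontrivial_of_isOpen_cantorSpace {D : Set (ℕ → Bool)} (hD : IsOpen D)
    (hD' : D.Nonempty) : D.Nontrivial := by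
  obtain ⟨s, hs⟩ := hD'
  have ht : Tendsto (fun n => Function.update s n (!s n)) atTop (𝓝 s) := by
    refine tendsto_pi_nhds.2 fun k => tendsto_const_nhds.congr' ?_
    filter_upwards [eventually_gt_atTop k] with n hn
    rw [Function.update_of_ne hn.ne]
  obtain ⟨n, hn⟩ := (ht.eventually (hD.mem_nhds hs)).exists
  refine ⟨s, hs, _, hn, fun he => ?_⟩
  have := congrFun he n
  rw [Function.update_self] at this
  cases hsn : s n <;> simp [hsn] at this

theorem nontrivial_of_isOpen_X {D : Set (X A A₀)} (hD : IsOpen D) (hD' : D.Nonempty) :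
    D.Nontrivial := by
  obtain ⟨⟨z, c⟩, hc⟩ := hD'
  let f : (ℕ → Bool) → X A A₀ := fun s => (z, cantorSetHomeomorphNatToBool.symm s)
  have hf : Continuous f :=
    continuous_const.prodMk cantorSetHomeomorphNatToBool.symm.continuous
  have hinj : Function.Injective f := fun s t hst =>
    cantorSetHomeomorphNatToBool.symm.injective (Prod.ext_iff.1 hst).2
  have := nontrivial_of_isOpen_cantorSpace (hD.preimage hf)
    ⟨cantorSetHomeomorphNatToBool c, by simpa [f] using hc⟩
  exact (this.image hinj).mono (image_preimage_subset _ _)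

theorem totallyDisconnectedSpace_cantorSet : TotallyDisconnectedSpace cantorSet :=
  cantorSetHomeomorphNatToBool.symm.totallyDisconnectedSpace

/-- If `A₀ ≠ A` there is a gap. -/
theorem SpiralPair.nonempty_gap (h : SpiralPair A A₀) (hne : A₀ ≠ A) : Nonempty (Gap A A₀) := by
  obtain ⟨x, hx, hx'⟩ := not_subset.1 fun hc => hne (h.subset.antisymm hc)
  exact ⟨⟨_, x, ⟨hx, hx'⟩, rfl⟩⟩

theorem isDenseType_T (h : SpiralPair A A₀) (hne : A₀ ≠ A)
    (hT : ∀ (W : Type) [Finite W] [Nonempty W] [TopologicalSpace W] [DiscreteTopology W]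
      (R : W → W → Prop), IsSurjectiveRelation R → Represents (T h) R) : IsDenseType (T h) := by
  obtain ⟨j⟩ := h.nonempty_gap hne
  have := compactSpace_Z h
  have := isCompact_iff_compactSpace.1 isCompact_cantorSet
  have := (isEmbedding_q_zeta h).t2Space
  have := totallyDisconnectedSpace_Z h
  have := totallyDisconnectedSpace_cantorSet
  have := (isEmbedding_q_zeta h).secondCountableTopology
  have : Nonempty (X A A₀) := ⟨wandering j 0, 0, zero_mem_cantorSet⟩
  exact isDenseType_of_represents (fun D => nontrivial_of_isOpen_X) (T h) hT

/-! ### Representation of relations -/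

/-- The iterates of a self-map of a finite set are eventually periodic. -/
theorem exists_iterate_periodic {W : Type*} [Finite W] (f : W → W) :
    ∃ N > 0, ∀ c k, N ≤ k → f^[k + c * N] = f^[k] := by
  obtain ⟨m, n, hmn, he⟩ := Finite.exists_ne_map_eq_of_infinite fun n : ℕ => f^[n]
  wlog hlt : m < n generalizing m n
  · exact this n m hmn.symm he.symm (by omega)
  have hstep : ∀ k, m ≤ k → f^[k + (n - m)] = f^[k] := by
    intro k hk
    obtain ⟨d, rfl⟩ := Nat.exists_eq_add_of_le hk
    rw [show m + d + (n - m) = d + n by omega, Function.iterate_add, ← he,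
      ← Function.iterate_add, add_comm]
  have hmul : ∀ c k, m ≤ k → f^[k + c * (n - m)] = f^[k] := by
    intro c k hk
    induction c with
    | zero => simp
    | succ c ih => rw [add_mul, one_mul, ← add_assoc, hstep _ (by omega), ih]
  -- A multiple of the period `n - m` that is at least the preperiod `m`, so one number serves as
  -- both.
  refine ⟨(m + 1) * (n - m), Nat.mul_pos (by omega) (by omega), fun c k hk => ?_⟩
  rw [← mul_assoc]
  refine hmul _ k (le_trans ?_ hk)
  have : 1 ≤ n - m := by omega
  nlinarith

/-- Every pair in a surjective relation on a finite set lies on a bi-infinite path which is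
eventually periodic in both directions. -/
theorem exists_path {W : Type*} [Finite W] {R : W → W → Prop} (hR : IsSurjectiveRelation R)
    {a b : W} (hab : R a b) :
    ∃ (N : ℕ) (w : ℤ → W), 0 < N ∧ w 0 = a ∧ w 1 = b ∧ (∀ n, R (w n) (w (n + 1))) ∧
      (∀ n : ℤ, N < n → w (n + N) = w n) ∧ ∀ n : ℤ, n < -N → w (n - N) = w n := by
  choose f hf using hR.1
  choose g hg using hR.2
  obtain ⟨N₁, hN₁, hf'⟩ := exists_iterate_periodic f
  obtain ⟨N₂, hN₂, hg'⟩ := exists_iterate_periodic g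
  have h1 : N₁ ≤ N₂ * N₁ := Nat.le_mul_of_pos_left _ hN₂
  have h2 : N₂ ≤ N₂ * N₁ := Nat.le_mul_of_pos_right _ hN₁
  -- Successors are chosen by `f` from `b` at index 1, predecessors by `g` from `a` at index 0. The
  -- product is a common period and exceeds neither threshold's reach, being at least `N₁` and `N₂`.
  refine ⟨N₂ * N₁, fun n => if 0 < n then f^[(n - 1).toNat] b else g^[(-n).toNat] a,
    Nat.mul_pos hN₂ hN₁, by simp, by simp, ?_, ?_, ?_⟩
  · intro n
    dsimp only
    rcases lt_trichotomy n 0 with hn | rfl | hn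
    · rw [if_neg (by omega), if_neg (by omega),
        show (-n).toNat = (-(n + 1)).toNat + 1 by omega, Function.iterate_succ_apply']
      exact hg _
    · simpa using hab
    · rw [if_pos hn, if_pos (by omega), show (n + 1 - 1).toNat = (n - 1).toNat + 1 by omega,
        Function.iterate_succ_apply']
      exact hf _
  · intro n hn
    dsimp only
    generalize hM : N₂ * N₁ = M at *
    rw [if_pos (by omega), if_pos (by omega),
      show (n + M - 1).toNat = (n - 1).toNat + M by omega, ← hM, hf' _ _ (by omega)]
  · intro n hn
    dsimp only
    generalize hM : N₂ * N₁ = M at *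
    rw [if_neg (by omega), if_neg (by omega),
      show (-(n - M)).toNat = (-n).toNat + M by omega, ← hM, mul_comm N₂, hg' _ _ (by omega)]

/-- A sequence that is periodic from some point on is, from there on, a function of the residue
class. -/
theorem exists_zmod_lift {W : Type*} {N : ℕ} (hN : 0 < N) {w : ℤ → W}
    (hw : ∀ n : ℤ, N < n → w (n + N) = w n) : ∃ r : ZMod N → W, ∀ n : ℤ, N < n → r n = w n := by
  have hmul : ∀ (c : ℕ) (n : ℤ), N < n → w (n + c * N) = w n := by
    intro c n hn
    induction c with
    | zero => simp
    | succ c ih =>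
      rw [Nat.cast_succ, add_mul, one_mul, ← add_assoc, hw _ (by nlinarith), ih]
  have hcongr : ∀ m n : ℤ, N < m → N < n → (m : ZMod N) = n → w m = w n := by
    intro m n hm hn hmn
    wlog hle : m ≤ n generalizing m n
    · exact (this n m hn hm hmn.symm (by omega)).symm
    obtain ⟨c, hc⟩ := (ZMod.intCast_eq_intCast_iff_dvd_sub m n N).1 hmn
    lift c to ℕ using by
      by_contra hneg
      have : (N : ℤ) * c < 0 := mul_neg_of_pos_of_neg (by omega) (by omega)
      omega
    rw [show n = m + c * N by linarith, hmul c m hm]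
  have : NeZero N := ⟨hN.ne'⟩
  -- The shift by `2 * N` puts the representative of `c` strictly beyond `N`.
  refine ⟨fun c => w (c.val + 2 * N), fun n hn => hcongr _ _ (by omega) hn ?_⟩
  push_cast
  simp

/-! ### Clopen labellings of the space of spirals -/

/-- The projection of `Θ` to `ℤ / N`. -/
def residue {N : ℕ} (hN : 0 < N) (t : Theta) : ZMod N := t.1 (N.toPNat hN)

theorem continuous_residue {N : ℕ} (hN : 0 < N) : Continuous (residue hN) :=
  (continuous_apply (N.toPNat hN)).comp continuous_subtype_val

theorem residue_add {N : ℕ} (hN : 0 < N) (s t : Theta) :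
    residue hN (s + t) = residue hN s + residue hN t := rfl

theorem residue_intCast {N : ℕ} (hN : 0 < N) (n : ℤ) : residue hN (n : Theta) = n := by
  let ev : Theta →+* ZMod N :=
    (Pi.evalRingHom (fun m : ℕ+ => ZMod (m : ℕ)) (N.toPNat hN)).comp thetaSubring.subtype
  exact map_intCast ev n

/-- Since `q` omits the values between consecutive positions, the strict cut at `n` is also the
non-strict cut at `n + 1`. -/
theorem isClopen_gapPoint_lt (h : SpiralPair A A₀) (j : Gap A A₀) (n : ℤ) :
    IsClopen {z : Z A A₀ | gapPoint j n < q z} := by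
  refine ⟨?_, isOpen_lt continuous_const continuous_q⟩
  have : {z : Z A A₀ | gapPoint j n < q z} = {z | gapPoint j (n + 1) ≤ q z} := by
    ext z
    exact ⟨fun hz => not_lt.1 fun hc => q_notMem_Ioo h z j n ⟨hz, hc⟩,
      fun hz => (gapPoint_strictMono h j (lt_add_one n)).trans_le hz⟩
  rw [this]
  exact isClosed_le continuous_const continuous_q

/-- Outside the gap `j`, the translation does not cross the wandering points of `j`. -/
theorem gapPoint_lt_q_shift_iff (h : SpiralPair A A₀) (j : Gap A A₀) (m : ℤ) {z : Z A A₀}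
    (hz : ∀ n, z ≠ wandering j n) : gapPoint j m < q (shift 1 z) ↔ gapPoint j m < q z := by
  rcases eq_adding_or_wandering h z with ⟨a, t, rfl⟩ | ⟨i, n, rfl⟩
  · rfl
  · rw [shift_wandering, q_wandering, q_wandering]
    have hlt := gapPoint_strictMono h i (lt_add_one n)
    refine ⟨fun hm => ?_, fun hm => hm.trans hlt⟩
    by_contra hc
    -- A crossing traps a position of `j` between two consecutive positions of `i`, which forces the
    -- gaps to coincide.
    obtain rfl : i = j := gap_eq ((Gap.ordConnected h i).out (gapPoint_mem h i n)
      (gapPoint_mem h i (n + 1)) ⟨not_lt.1 hc, hm.le⟩) (gapPoint_mem h j m)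
    exact hz n rfl

/-- A pair of a surjective relation on a finite set is realized by a clopen labelling of
`Z(A, A₀)` along whose orbits only pairs of the relation occur. -/
theorem exists_labelling (h : SpiralPair A A₀) (j : Gap A A₀) {W : Type*} [Finite W]
    [TopologicalSpace W] [DiscreteTopology W] {R : W → W → Prop} (hR : IsSurjectiveRelation R)
    {a b : W} (hab : R a b) :
    ∃ φ : Z A A₀ → W, Continuous φ ∧ (∀ z, R (φ z) (φ (shift 1 z))) ∧
      ∃ z, φ z = a ∧ φ (shift 1 z) = b := by
  classical
  obtain ⟨N, w, hN, hw0, hw1, hwR, hwr, hwl⟩ := exists_path hR hab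
  obtain ⟨r, hr⟩ := exists_zmod_lift hN hwr
  -- The left tail is handled as the right tail of the reflected path.
  obtain ⟨l', hl'⟩ := exists_zmod_lift (w := fun n => w (-n)) hN fun n hn => by
    rw [neg_add, ← sub_eq_add_neg, hwl _ (by omega)]
  have hl : ∀ n : ℤ, n < -N → l' (-n) = w n := by
    intro n hn
    have := hl' (-n) (by omega)
    rwa [neg_neg, Int.cast_neg] at this
  have h4N : 0 < 4 * N := by omega
  have : NeZero (4 * N) := ⟨h4N.ne'⟩
  have : NeZero N := ⟨hN.ne'⟩
  -- The middle window contains only the wandering points with index from `-N` to `N`. There the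
  -- least absolute residue mod `4 * N` recovers the index, so all three branches are locally
  -- constant functions of `ζ`.
  let φ : Z A A₀ → W := fun z =>
    if gapPoint j N < q z then r (residue hN (zeta z))
    else if gapPoint j (-N - 1) < q z then w (residue h4N (zeta z)).valMinAbs
    else l' (-residue hN (zeta z))
  have hφj : ∀ n, φ (wandering j n) = w n := by
    intro n
    simp only [φ, q_wandering, zeta_wandering, residue_intCast,
      (gapPoint_strictMono h j).lt_iff_lt]
    split_ifs with h1 h2
    · exact hr n h1
    · rw [(ZMod.valMinAbs_spec _ n).2 ⟨rfl, by push_cast; constructor <;> omega⟩]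
    · exact hl n (by omega)
  refine ⟨φ, ?_, ?_, wandering j 0, ?_, ?_⟩
  · have hcont : ∀ {K : ℕ} (hK : 0 < K) (F : ZMod K → W),
        Continuous fun z : Z A A₀ => F (residue hK (zeta z)) := fun hK F =>
      continuous_of_discreteTopology.comp ((continuous_residue hK).comp continuous_zeta)
    refine Continuous.if (fun z hz => ?_) (hcont hN r)
      (Continuous.if (fun z hz => ?_) (hcont h4N fun c => w c.valMinAbs)
        (hcont hN fun c => l' (-c)))
    all_goals
      rw [(isClopen_gapPoint_lt h j _).frontier_eq] at hz
      exact hz.elim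
  · intro z
    by_cases hz : ∃ n, z = wandering j n
    · obtain ⟨n, rfl⟩ := hz
      rw [shift_wandering, hφj, hφj]
      exact hwR n
    · push Not at hz
      simp only [φ, gapPoint_lt_q_shift_iff h j _ hz, zeta_shift, residue_add, residue_intCast]
      -- Off the orbit, the residue is lifted to an index `n` with `n` and `n + 1` both in a
      -- periodic tail, where the path gives the relation. On the right `d = 2` gives `n > N`; on
      -- the left `d = -3` is needed, since `d = -2` could give `n + 1 = -N`.
      have hres : ∀ d : ℤ, residue hN (zeta z) =
          (((residue hN (zeta z)).val + d * N : ℤ) : ZMod N) := by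
        intro d
        push_cast
        simp
      split_ifs with h1 h2
      · rw [hres 2, ← Int.cast_add, hr _ (by omega), hr _ (by omega)]
        exact hwR _
      · obtain ⟨n, hn⟩ := eq_wandering_of_q_mem h ((Gap.ordConnected h j).out
          (gapPoint_mem h j (-N - 1)) (gapPoint_mem h j N) ⟨h2.le, not_lt.1 h1⟩)
        exact absurd hn (hz n)
      · have hval := (residue hN (zeta z)).val_lt
        rw [hres (-3), ← Int.cast_add, hl _ (by omega), hl _ (by omega)]
        exact hwR _
  · rw [hφj, hw0]
  · rw [shift_wandering, hφj, zero_add, hw1]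

/-- `T` fixes the Cantor coordinate, so that coordinate can select a labelling for each pair in `R`.
Each labelling realizes its own pair and produces none outside `R`; surjectivity onto `W` follows
from that of `R`. -/
theorem represents_T (h : SpiralPair A A₀) (j : Gap A A₀) {W : Type*} [Finite W] [Nonempty W]
    [TopologicalSpace W] [DiscreteTopology W] {R : W → W → Prop} (hR : IsSurjectiveRelation R) :
    Represents (T h) R := by
  let E := {p : W × W // R p.1 p.2}
  have : Nonempty E := by
    obtain ⟨b, hb⟩ := hR.1 (Classical.arbitrary W)
    exact ⟨⟨(_, b), hb⟩⟩
  let := TopologicalSpace.metrizableSpaceMetric E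
  -- The set of pairs is finite and discrete, hence compact metrizable, hence a continuous image of
  -- the Cantor space.
  obtain ⟨s, hs, hs'⟩ := exists_nat_bool_continuous_surjective_of_compact E
  choose ψ hψ hψR z hza hzb using fun e : E => exists_labelling h j hR e.2
  let e : cantorSet → E := fun c => s (cantorSetHomeomorphNatToBool c)
  have he : Continuous e := hs.comp cantorSetHomeomorphNatToBool.continuous
  have he' : Function.Surjective e := hs'.comp cantorSetHomeomorphNatToBool.surjective
  have hrep : ∀ a b, R a b ↔ ∃ x : X A A₀, ψ (e x.2) x.1 = a ∧ ψ (e x.2) (T h x).1 = b := by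
    intro a b
    constructor
    · intro hab
      obtain ⟨c, hc⟩ := he' ⟨(a, b), hab⟩
      refine ⟨(z (e c), c), ?_, ?_⟩
      · rw [hza, hc]
      · exact (hzb (e c)).trans (by rw [hc])
    · rintro ⟨x, rfl, rfl⟩
      exact hψR (e x.2) x.1
  refine ⟨fun x => ψ (e x.2) x.1, ?_, ?_, hrep⟩
  · have hc : Continuous fun p : E × Z A A₀ => ψ p.1 p.2 :=
      continuous_prod_of_discrete_left.2 hψ
    exact hc.comp ((he.comp continuous_snd).prodMk continuous_fst)
  · intro a
    obtain ⟨b, hab⟩ := hR.1 a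
    obtain ⟨x, hx, -⟩ := (hrep a b).1 hab
    exact ⟨x, hx⟩

end SpiralSpace

theorem proposition3p2 (A A₀ : Set ℝ) (h : SpiralSpace.SpiralPair A A₀) (hne : A₀ ≠ A) :
    SpiralSpace.IsDenseType (SpiralSpace.T h) ∧
    ∀ (W : Type*) [Finite W] [Nonempty W] [TopologicalSpace W] [DiscreteTopology W]
      (R : W → W → Prop), SpiralSpace.IsSurjectiveRelation R →
        SpiralSpace.Represents (SpiralSpace.T h) R := by
  obtain ⟨j⟩ := h.nonempty_gap hne
  refine ⟨SpiralSpace.isDenseType_T h hne ?_, ?_⟩ <;>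
  · intro W _ _ _ _ R hR
    exact SpiralSpace.represents_T h j hR
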